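/- For distinct points $V_0,\dots,V_4$ on the unit sphere $S^2\subset\mathbb R^3$ and $s>0$ let $R_s(V_0,\dots,V_4)=\sum_{i<j}\|V_i-V_j\|^{-s}$. A quadruple $X=(p_0,p_1,p_2,p_3)$ of points of $\mathbb R^2$ represents the five-point configuration $\Sigma^{-1}(p_0),\dots,\Sigma^{-1}(p_3),(0,0,1)$, where $$\Sigma^{-1}(x,y)=\Bigl(\tfrac{2x}{1+x^2+y^2},\ \tfrac{2y}{1+x^2+y^2},\ 1-\tfrac{2}{1+x^2+y^2}\Bigr)$$ is inverse stereographic projection, and $R_s(X)$ denotes the energy of this configuration. Let SMALL be the set of all quadruples $X$ such that 1. $\|p_0\|\ge\|p_k\|$ for $k=1,2,3$; 2. $512\,p_0\in[433,498]\times\{0\}$; 3. $512\,p_1\in[-16,16]\times[-464,-349]$; 4. $512\,p_2\in[-498,-400]\times[0,24]$; 5. $512\,p_3\in[-16,16]\times[349,464]$. For $X\in$ SMALL let $X'=(p_0',p_1',p_2',p_3')$ be obtained by rotating $X$ about the origin so that $p_0'$ and $p_2'$ lie on the same horizontal line with $p_0'$ to the right of $p_2'$. Write $p'_k=(p'_{k1},p'_{k2})$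 and define $X^*=(p_0^*,p_1^*,p_2^*,p_3^*)$ by $$-p_2^*=p_0^*=\Bigl(\frac{p'_{01}-p'_{21}}2,\,0\Bigr),\qquad -p_3^*=p_1^*=\Bigl(0,\,\frac{p'_{12}-p'_{32}}2\Bigr).$$ **Symmetrization Lemma.** Let $s\in[12,\,15+25/512]$ and $X\in$ SMALL. Then $X^*$ is a nondegenerate rhombus with vertices on the coordinate axes, $p_0^*=(x,0)$, $p_1^*=(0,-y)$, $p_2^*=(-x,0)$, $p_3^*=(0,y)$ with $x,y>0$, and $R_s(X^*)\le R_s(X)$, with equality if and only if $X=X^*$. -/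

import Mathlib

noncomputable section

namespace FivePoint

/-- The Euclidean plane. -/
abbrev Plane : Type := EuclideanSpace ℝ (Fin 2)

/-- Euclidean 3-space. -/
abbrev Space : Type := EuclideanSpace ℝ (Fin 3)

/-- The total `f`-potential of a list of points: the sum of `f (‖P i - P j‖)` over `i < j`. -/
def potential (f : ℝ → ℝ) {n : ℕ} (P : Fin n → Space) : ℝ :=
  ∑ i : Fin n, ∑ j ∈ Finset.Ioi i, f ‖P i - P j‖

/-- The power law `R_s(r) = sign(s) r^(-s)`. -/
def powerLaw (s r : ℝ) : ℝ := Real.sign s * r ^ (-s)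

/-- Stereographic projection from the point `(0,0,1)`. -/
def stereo (v : Space) : Plane := !₂[v 0 / (1 - v 2), v 1 / (1 - v 2)]

/-- Inverse stereographic projection, from the plane to the unit sphere. -/
def invStereo (p : Plane) : Space :=
  !₂[2 * p 0 / (1 + p 0 ^ 2 + p 1 ^ 2), 2 * p 1 / (1 + p 0 ^ 2 + p 1 ^ 2),
    1 - 2 / (1 + p 0 ^ 2 + p 1 ^ 2)]

/-- The point `(0,0,1)`. -/
def northPole : Space := !₂[0, 0, 1]

theorem norm_invStereo (p : Plane) : ‖invStereo p‖ = 1 := by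
  have h : (1 + p 0 ^ 2 + p 1 ^ 2) ≠ 0 := by positivity
  rw [EuclideanSpace.norm_eq, Real.sqrt_eq_one]
  simp only [Fin.sum_univ_three, Real.norm_eq_abs, sq_abs]
  simp [invStereo]
  field_simp
  ring

theorem stereo_invStereo (p : Plane) : stereo (invStereo p) = p := by
  have h : (1 + p 0 ^ 2 + p 1 ^ 2) ≠ 0 := by positivity
  ext i
  fin_cases i <;> simp [stereo, invStereo] <;> field_simp

/-- The 5-point configuration on the sphere that has stereographic coordinates
`X 0, X 1, X 2, X 3`; its fifth point is `(0,0,1)`. -/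
def configuration (X : Fin 4 → Plane) : Fin 5 → Space :=
  ![invStereo (X 0), invStereo (X 1), invStereo (X 2), invStereo (X 3), northPole]

/-- The `R_s`-energy of the 5-point configuration with stereographic coordinates `X`. -/
def rieszEnergy (s : ℝ) (X : Fin 4 → Plane) : ℝ :=
  potential (powerLaw s) (configuration X)

/-- The domain `SMALL`, in stereographic coordinates. -/
def SMALL : Set (Fin 4 → Plane) :=
  {X | (∀ k, ‖X k‖ ≤ ‖X 0‖) ∧
    (512 * X 0 0 ∈ Set.Icc (433 : ℝ) 498 ∧ X 0 1 = 0) ∧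
    (512 * X 1 0 ∈ Set.Icc (-16 : ℝ) 16 ∧ 512 * X 1 1 ∈ Set.Icc (-464 : ℝ) (-349)) ∧
    (512 * X 2 0 ∈ Set.Icc (-498 : ℝ) (-400) ∧ 512 * X 2 1 ∈ Set.Icc (0 : ℝ) 24) ∧
    (512 * X 3 0 ∈ Set.Icc (-16 : ℝ) 16 ∧ 512 * X 3 1 ∈ Set.Icc (349 : ℝ) 464)}

/-- The configurations whose stereographic coordinates are the vertices of a (nondegenerate)
rhombus with vertices on the coordinate axes, labelled as in `SMALL`. -/
def K4 : Set (Fin 4 → Plane) :=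
  {X | ∃ x y : ℝ, 0 < x ∧ 0 < y ∧ X = ![!₂[x, 0], !₂[0, -y], !₂[-x, 0], !₂[0, y]]}

/-- Counterclockwise rotation of the plane about the origin by the angle `θ`. -/
def rotate (θ : ℝ) (p : Plane) : Plane :=
  !₂[Real.cos θ * p 0 - Real.sin θ * p 1, Real.sin θ * p 0 + Real.cos θ * p 1]

/-- The rotation angle which makes `X 0` and `X 2` lie on a horizontal line, with `X 0` on
the right: minus the angle of the vector `X 0 - X 2`. -/
def alignAngle (X : Fin 4 → Plane) : ℝ :=
  -Complex.arg ⟨X 0 0 - X 2 0, X 0 1 - X 2 1⟩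

/-- The configuration `X'`, obtained by rotating `X` about the origin so that the points of
index `0` and `2` lie on the same horizontal line, with the former on the right. -/
def align (X : Fin 4 → Plane) : Fin 4 → Plane :=
  fun k => rotate (alignAngle X) (X k)

/-- The symmetrization `X*`:
`-p₂* = p₀* = ((p'₀₁ - p'₂₁) / 2, 0)` and `-p₃* = p₁* = (0, (p'₁₂ - p'₃₂) / 2)`. -/
def symmetrize (X : Fin 4 → Plane) : Fin 4 → Plane :=
  let a : ℝ := (align X 0 0 - align X 2 0) / 2
  let b : ℝ := (align X 1 1 - align X 3 1) / 2
  ![!₂[a, 0], !₂[0, b], !₂[-a, 0], !₂[0, -b]]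

/-- The rotation in the definition of `align` is, up to a full turn, the only one that has
the property described there. -/
theorem align_iff (X : Fin 4 → Plane) (hX : X 0 ≠ X 2) (θ : ℝ) :
    (rotate θ (X 0) 1 = rotate θ (X 2) 1 ∧ rotate θ (X 2) 0 < rotate θ (X 0) 0) ↔
      (θ : Real.Angle) = (alignAngle X : Real.Angle) := by
  set z : ℂ := ⟨X 0 0 - X 2 0, X 0 1 - X 2 1⟩ with hz
  have hz0 : z ≠ 0 := by
    intro h
    apply hX
    ext i
    have h1 := congrArg Complex.re h
    have h2 := congrArg Complex.im h
    simp [hz] at h1 h2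
    fin_cases i
    · simpa using sub_eq_zero.mp h1
    · simpa using sub_eq_zero.mp h2
  have hn : 0 < ‖z‖ := norm_pos_iff.mpr hz0
  have hc : X 0 0 - X 2 0 = ‖z‖ * Real.cos z.arg := by
    rw [Complex.cos_arg hz0]; field_simp; rfl
  have hs : X 0 1 - X 2 1 = ‖z‖ * Real.sin z.arg := by
    rw [Complex.sin_arg]; field_simp; rfl
  have e1 : rotate θ (X 0) 1 - rotate θ (X 2) 1 = ‖z‖ * Real.sin (θ + z.arg) := by
    rw [Real.sin_add]; simp only [rotate]; simp
    linear_combination Real.sin θ * hc + Real.cos θ * hs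
  have e2 : rotate θ (X 0) 0 - rotate θ (X 2) 0 = ‖z‖ * Real.cos (θ + z.arg) := by
    rw [Real.cos_add]; simp only [rotate]; simp
    linear_combination Real.cos θ * hc - Real.sin θ * hs
  have e3 : (θ : Real.Angle) = (alignAngle X : Real.Angle) ↔
      ((θ + z.arg : ℝ) : Real.Angle) = 0 := by
    rw [alignAngle, ← hz, Real.Angle.coe_neg, Real.Angle.coe_add, eq_neg_iff_add_eq_zero]
  rw [e3, ← sub_eq_zero, ← sub_pos (b := rotate θ (X 2) 0), e1, e2, mul_pos_iff_of_pos_left hn,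
    mul_eq_zero, or_iff_right hn.ne']
  constructor
  · rintro ⟨h1, h2⟩
    have hsq := Real.sin_sq_add_cos_sq (θ + z.arg)
    rw [h1] at hsq
    apply Real.Angle.cos_sin_inj
    · rw [Real.cos_zero]; nlinarith
    · rw [Real.sin_zero, h1]
  · intro h
    have h1 : Real.Angle.sin ((θ + z.arg : ℝ) : Real.Angle) = 0 := by rw [h]; simp
    have h2 : Real.Angle.cos ((θ + z.arg : ℝ) : Real.Angle) = 1 := by rw [h]; simp
    rw [Real.Angle.sin_coe] at h1
    rw [Real.Angle.cos_coe] at h2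
    exact ⟨h1, by rw [h2]; norm_num⟩

end FivePoint

end

namespace FivePoint

/-! Put `t = s / 2`, which lies in `[6, 8]`. Up to a constant factor the energy is a sum of `t`-th
powers: of `height p` for the bonds to the pole and of `bond p q` for the others. It is invariant
under rotation, so after aligning, the four points are `(a + u, h)`, `(x₁, -(b - k))`, `(-(a - u),
h)`, `(x₃, b + k)`, and symmetrizing means setting `u = h = k = x₁ = x₃ = 0`. The core is
`energy_lt`: any nonzero deviation strictly costs energy. It combines two moves.

Horizontal move (`u`, `x₁`, `x₃` to zero). The terms are paired so that, by AM-GM, only products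
matter: the two polar bonds of the horizontal pair, and the two sides at each vertex of the vertical
pair (`side_pair_ge`). The vertical diagonal may lose energy when `x₁ ≠ x₃`, but half of the gain in
the polar bonds of the vertical pair pays for that (`diagonal_le`).

Vertical move (`h`, `k` to zero). The sides alone may lose energy at second order, while the polar
bonds of the vertical pair gain a multiple of `k ^ 2` (`pole_pair_le`). Bernoulli's inequality
linearizes the powers, and the balance is bounded below by a positive definite quadratic form in
`h`, `k` (`side_form_pos`, `vertical_step`). -/

/-! ### Elementary inequalities for real powers. -/

/-- Bernoulli's inequality, as the tangent line of `x ↦ x ^ t` at `x₀`. -/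
theorem tangent_le_rpow {t x₀ x : ℝ} (ht : 1 ≤ t) (h₀ : 0 < x₀) (hx : 0 ≤ x) :
    x₀ ^ t * (1 + t * (x / x₀ - 1)) ≤ x ^ t := by
  have h := one_add_mul_self_le_rpow_one_add (s := x / x₀ - 1) (by
    have : 0 ≤ x / x₀ := by positivity
    linarith) ht
  have e : x ^ t = x₀ ^ t * (x / x₀) ^ t := by
    rw [← Real.mul_rpow h₀.le (by positivity)]
    congr 1
    field_simp
  rw [e]
  have e2 : 1 + (x / x₀ - 1) = x / x₀ := by ring
  rw [e2] at h
  exact mul_le_mul_of_nonneg_left h (by positivity)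

theorem two_mul_rpow_mean_le {t x y : ℝ} (ht : 1 ≤ t) (hx : 0 < x) (hy : 0 < y) :
    2 * ((x + y) / 2) ^ t ≤ x ^ t + y ^ t := by
  have h0 : 0 < (x + y) / 2 := by positivity
  have h1 := tangent_le_rpow ht h0 hx.le
  have h2 := tangent_le_rpow ht h0 hy.le
  have e : ((x + y) / 2) ^ t * (1 + t * (x / ((x + y) / 2) - 1)) +
      ((x + y) / 2) ^ t * (1 + t * (y / ((x + y) / 2) - 1)) = 2 * ((x + y) / 2) ^ t := by
    have : x / ((x + y) / 2) + y / ((x + y) / 2) = 2 := by field_simp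
    linear_combination ((x + y) / 2) ^ t * t * this
  linarith

/-- The inequality between the arithmetic and the geometric mean, for `t`-th powers. -/
theorem two_mul_rpow_le_add {t x y z : ℝ} (ht : 0 ≤ t) (hx : 0 ≤ x) (hy : 0 ≤ y) (hz : 0 ≤ z)
    (h : z ^ 2 ≤ x * y) : 2 * z ^ t ≤ x ^ t + y ^ t := by
  have h1 : (z ^ t) ^ 2 ≤ x ^ t * y ^ t := by
    rw [← Real.mul_rpow hx hy, sq, ← Real.mul_rpow hz hz, ← sq]
    exact Real.rpow_le_rpow (by positivity) h ht
  have hx' : 0 ≤ x ^ t := by positivity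
  have hy' : 0 ≤ y ^ t := by positivity
  refine abs_le_of_sq_le_sq' ?_ (by positivity) |>.2
  nlinarith [sq_nonneg (x ^ t - y ^ t)]

theorem two_mul_rpow_lt_add {t x y z : ℝ} (ht : 0 < t) (hx : 0 ≤ x) (hy : 0 ≤ y) (hz : 0 ≤ z)
    (h : z ^ 2 < x * y) : 2 * z ^ t < x ^ t + y ^ t := by
  have h1 : z < √(x * y) := Real.lt_sqrt_of_sq_lt h
  have h2 := two_mul_rpow_le_add ht.le hx hy (Real.sqrt_nonneg (x * y))
    (by rw [Real.sq_sqrt (by positivity)])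
  have h3 := Real.rpow_lt_rpow hz h1 ht
  linarith

/-- Bernoulli with exponent `t / 6 ≥ 1` is applied to the sixth powers of `1 - z` and `1 + z`, whose
sum is an explicit even polynomial. The coefficient `5 * t` equals the true second-order coefficient
`t * (t - 1)` at `t = 6`. -/
theorem two_add_le_rpow_add_rpow {t z : ℝ} (ht : 6 ≤ t) (h₁ : -1 < z) (h₂ : z < 1) :
    2 + 5 * t * z ^ 2 ≤ (1 - z) ^ t + (1 + z) ^ t := by
  have key : ∀ y : ℝ, 0 < y → 1 + t / 6 * (y ^ 6 - 1) ≤ y ^ t := by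
    intro y hy
    have h := one_add_mul_self_le_rpow_one_add (s := y ^ 6 - 1) (p := t / 6)
      (by have : 0 ≤ y ^ 6 := by positivity
          linarith) (by linarith)
    have e : (1 + (y ^ 6 - 1)) ^ (t / 6) = y ^ t := by
      rw [show 1 + (y ^ 6 - 1) = y ^ (6 : ℝ) by norm_num, ← Real.rpow_mul hy.le]
      congr 1
      ring
    rwa [e] at h
  have k1 := key (1 - z) (by linarith)
  have k2 := key (1 + z) (by linarith)
  have e : (1 + t / 6 * ((1 - z) ^ 6 - 1)) + (1 + t / 6 * ((1 + z) ^ 6 - 1))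
      = 2 + 5 * t * z ^ 2 + t * (5 * z ^ 4 + z ^ 6 / 3) := by ring
  have : 0 ≤ t * (5 * z ^ 4 + z ^ 6 / 3) := by positivity
  linarith

/-! ### The vertical move: `h` and `k` to zero. -/

/-- The two points at heights `b - k` and `b + k` below and above the origin. -/
theorem pole_pair_le {t b k : ℝ} (ht : 6 ≤ t) :
    (1 + b ^ 2) ^ t * (2 + t * k ^ 2 * (2 / (1 + b ^ 2) + 20 * b ^ 2 / (1 + b ^ 2 + k ^ 2) ^ 2)) ≤
      (1 + (b - k) ^ 2) ^ t + (1 + (b + k) ^ 2) ^ t := by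
  set n := 1 + b ^ 2 with hn
  have hn0 : 0 < n := by positivity
  -- Factoring out `ν` splits the effect of `k`: the common factor `ν ^ t` grows with `k ^ 2`, and
  -- the remaining factors are `1 - z` and `1 + z`.
  set ν := n + k ^ 2 with hν
  have hν0 : 0 < ν := by positivity
  set z := 2 * b * k / ν with hz
  have hzν : z * ν = 2 * b * k := by rw [hz]; field_simp
  have e1 : 1 + (b - k) ^ 2 = ν * (1 - z) := by rw [mul_sub, mul_comm ν z, hzν]; ring
  have e2 : 1 + (b + k) ^ 2 = ν * (1 + z) := by rw [mul_add, mul_comm ν z, hzν]; ring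
  have p1 : 0 < 1 - z := by
    have : 0 < ν * (1 - z) := by rw [← e1]; positivity
    exact (mul_pos_iff_of_pos_left hν0).1 this
  have p2 : 0 < 1 + z := by
    have : 0 < ν * (1 + z) := by rw [← e2]; positivity
    exact (mul_pos_iff_of_pos_left hν0).1 this
  have h1 := two_add_le_rpow_add_rpow ht (by linarith) (by linarith : z < 1)
  have h2 := tangent_le_rpow (by linarith : 1 ≤ t) hn0 hν0.le
  have e3 : ν / n - 1 = k ^ 2 / n := by rw [hν]; field_simp; ring
  have e4 : 20 * b ^ 2 / ν ^ 2 * k ^ 2 = 5 * z ^ 2 := by rw [hz]; field_simp; ring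
  rw [e3] at h2
  rw [e1, e2, Real.mul_rpow hν0.le p1.le, Real.mul_rpow hν0.le p2.le, ← mul_add]
  have hnt : 0 < n ^ t := by positivity
  have hkn : 0 ≤ k ^ 2 / n := by positivity
  calc n ^ t * (2 + t * k ^ 2 * (2 / n + 20 * b ^ 2 / ν ^ 2))
      = n ^ t * (2 + 2 * t * (k ^ 2 / n) + 5 * t * z ^ 2) := by
        linear_combination n ^ t * t * e4
    _ ≤ n ^ t * ((1 + t * (k ^ 2 / n)) * (2 + 5 * t * z ^ 2)) := by
        apply mul_le_mul_of_nonneg_left _ hnt.le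
        have : 0 ≤ t * (k ^ 2 / n) * (5 * t * z ^ 2) := by positivity
        linarith
    _ = (n ^ t * (1 + t * (k ^ 2 / n))) * (2 + 5 * t * z ^ 2) := by ring
    _ ≤ ν ^ t * (2 + 5 * t * z ^ 2) :=
        mul_le_mul_of_nonneg_right h2 (by positivity)
    _ ≤ _ := mul_le_mul_of_nonneg_left h1 (by positivity)

/-- Negative discriminant of the form in `side_form_pos`, with `α = a ^ 2` and `β = b ^ 2`. -/
theorem side_discriminant_neg {α β : ℝ} (h₁ : 0.66 ≤ α) (h₂ : α ≤ 0.95) (h₃ : 0.4625 ≤ β) :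
    (8 * (1 + α) * (α + 3 * α * β - 3 * β - β ^ 2) + 8 * (1 + α) * (1 + β) * 0.0201) ^ 2 <
      4 * (4 * (1 + β) * (0.999 * (α + β) ^ 2 + (1 + α) * (3 * β - α))
          - 4 * (1 + α) * (1 + β) * 0.0201) *
        (4 * (1 + α) * (3 * β - α) * (1 - α) - 4 * (1 + α) * (1 + β) * 0.0201 +
          0.99 * 0.1001 * (α + β) ^ 2 * (32 / 3 * (α + β) - 7 * (1 + α)) * 8.2) := by
  obtain ⟨p, rfl⟩ : ∃ p, α = 0.95 - p := ⟨0.95 - α, by ring⟩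
  obtain ⟨q, rfl⟩ : ∃ q, β = 0.4625 + q := ⟨β - 0.4625, by ring⟩
  have hp : 0 ≤ p := by linarith
  have hq : 0 ≤ q := by linarith
  have hp' : 0 ≤ 0.29 - p := by linarith
  -- In the shifted variables the claim follows from linear arithmetic on monomials, some of them
  -- multiplied by `0.29 - p`, the slack in the lower bound on `α`.
  have k₁ : ∀ i j : ℕ, 0 ≤ q ^ j * p ^ i := fun i j => by positivity
  have k₂ : ∀ i j : ℕ, 0 ≤ q ^ j * p ^ i * (0.29 - p) := fun i j => by positivity
  rw [← sub_pos]
  ring_nf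
  linarith [k₁ 1 0, k₁ 3 0, k₁ 5 0, k₂ 0 0, k₂ 1 0, k₂ 2 0, k₂ 3 0, k₁ 0 1, k₁ 2 1, k₁ 4 1, k₁ 5 1,
    k₂ 0 1, k₂ 1 1, k₂ 2 1, k₁ 0 2, k₁ 2 2, k₂ 0 2, k₂ 1 2, k₂ 2 2, k₂ 3 2, k₁ 0 3, k₁ 2 3, k₂ 0 3,
    k₂ 1 3, k₂ 2 3, k₁ 0 4, k₂ 0 4, k₁ 2 4, k₁ 0 5, k₂ 0 5, k₁ 0 6]
theorem side_leading_pos {α β : ℝ} (h₁ : 0.66 ≤ α) (h₂ : α ≤ 0.95) (h₃ : 0.4625 ≤ β) :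
    0 < 4 * (1 + β) * (0.999 * (α + β) ^ 2 + (1 + α) * (3 * β - α))
          - 4 * (1 + α) * (1 + β) * 0.0201 := by
  have : 0 < 0.999 * (α + β) ^ 2 + (1 + α) * (3 * β - α) - (1 + α) * 0.0201 := by nlinarith
  nlinarith

/-- The form is the second-order part of the side terms, weakened by safety margins: `0.999` and
`0.0201` absorb higher-order terms. The summand with the factor `8.2` is the gain from the polar
bonds, a product of the bounds in `side_denominator_ge`, `linear_le_rpow` and `pole_coefficient_ge`.
-/
theorem side_form_pos {α β h k : ℝ} (h₁ : 0.66 ≤ α) (h₂ : α ≤ 0.95) (h₃ : 0.4625 ≤ β)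
    (hk : h ≠ 0 ∨ k ≠ 0) :
    0 < (4 * (1 + β) * (0.999 * (α + β) ^ 2 + (1 + α) * (3 * β - α))
          - 4 * (1 + α) * (1 + β) * 0.0201) * h ^ 2 +
        (8 * (1 + α) * (α + 3 * α * β - 3 * β - β ^ 2) + 8 * (1 + α) * (1 + β) * 0.0201) *
          (h * k) +
        (4 * (1 + α) * (3 * β - α) * (1 - α) - 4 * (1 + α) * (1 + β) * 0.0201 +
          0.99 * 0.1001 * (α + β) ^ 2 * (32 / 3 * (α + β) - 7 * (1 + α)) * 8.2) * k ^ 2 := by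
  have hd := side_discriminant_neg h₁ h₂ h₃
  have hl := side_leading_pos h₁ h₂ h₃
  generalize 4 * (1 + β) * (0.999 * (α + β) ^ 2 + (1 + α) * (3 * β - α))
    - 4 * (1 + α) * (1 + β) * 0.0201 = H at *
  generalize 8 * (1 + α) * (α + 3 * α * β - 3 * β - β ^ 2) + 8 * (1 + α) * (1 + β) * 0.0201 = L at *
  generalize 4 * (1 + α) * (3 * β - α) * (1 - α) - 4 * (1 + α) * (1 + β) * 0.0201 +
    0.99 * 0.1001 * (α + β) ^ 2 * (32 / 3 * (α + β) - 7 * (1 + α)) * 8.2 = K at *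
  have e : 4 * H * (H * h ^ 2 + L * (h * k) + K * k ^ 2) =
      (2 * H * h + L * k) ^ 2 + (4 * H * K - L ^ 2) * k ^ 2 := by ring
  have hp : 0 < 4 * H * (H * h ^ 2 + L * (h * k) + K * k ^ 2) := by
    rw [e]
    by_cases hk0 : k = 0
    · subst hk0
      have : h ≠ 0 := by simpa using hk
      have : 0 < (2 * H * h + L * 0) ^ 2 := by
        have : 2 * H * h ≠ 0 := by positivity
        rw [mul_zero, add_zero]
        positivity
      linarith
    · have : 0 < (4 * H * K - L ^ 2) * k ^ 2 :=
        mul_pos (by linarith) (by positivity)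
      nlinarith [sq_nonneg (2 * H * h + L * k)]
  exact (mul_pos_iff_of_pos_left (by positivity)).1 hp

/-- The numerator of the relative increase of the mean of two side terms, plus a multiple
of `k ^ 2`. -/
theorem side_numerator_pos {α β h k : ℝ} (h₁ : 0.66 ≤ α) (h₂ : α ≤ 0.95) (h₃ : 0.4625 ≤ β)
    (h₄ : β ≤ 0.83) (hg : (h - k) ^ 2 ≤ 0.0201) (hk2 : k ^ 2 ≤ 0.0129) (hk : h ≠ 0 ∨ k ≠ 0) :
    0 < 4 * ((1 + α + h ^ 2) * (α + β) * ((1 + β + k ^ 2) * (α + β + (h - k) ^ 2) +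
          4 * β * k * (h - k)) -
        (1 + α) * (1 + β) * ((α + β + (h - k) ^ 2) ^ 2 - 4 * β * (h - k) ^ 2)) +
      0.99 * 0.1001 * (α + β) ^ 2 * (32 / 3 * (α + β) - 7 * (1 + α)) * 8.2 * k ^ 2 := by
  have hf := side_form_pos h₁ h₂ h₃ hk
  obtain ⟨g, hgdef⟩ : ∃ g, g = h - k := ⟨_, rfl⟩
  rw [← hgdef] at hg ⊢
  have hR : 0 < α + β := by linarith
  have hg2 := sq_nonneg g
  have hk0 := sq_nonneg k
  -- the bracket multiplying `h ^ 2`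
  have b1 : 0.999 * ((1 + β) * (α + β)) ≤
      (1 + β + k ^ 2) * (α + β + g ^ 2) + 4 * β * k * g := by
    -- Discriminant condition for the form in `k`, `g` of `c2`. Without the extra `0.02` it fails at
    -- `α = 0.66`, `β = 0.83`; the borrowed `0.02 * k ^ 2` is repaid in `c3` out of the factor
    -- `0.999`.
    have c1 : 4 * β ^ 2 ≤ (α + β + 0.02) * (1 + β) := by nlinarith
    have c2 : 0 ≤ (α + β + 0.02) * k ^ 2 + 4 * β * k * g + (1 + β) * g ^ 2 := by
      have hp : 0 < 1 + β := by linarith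
      have e : (1 + β) * ((α + β + 0.02) * k ^ 2 + 4 * β * k * g + (1 + β) * g ^ 2) =
          ((1 + β) * g + 2 * β * k) ^ 2 + ((α + β + 0.02) * (1 + β) - 4 * β ^ 2) * k ^ 2 := by
        ring
      have : 0 ≤ (1 + β) * ((α + β + 0.02) * k ^ 2 + 4 * β * k * g + (1 + β) * g ^ 2) := by
        rw [e]
        have := mul_nonneg (sub_nonneg.2 c1) hk0
        positivity
      exact (mul_nonneg_iff_of_pos_left hp).1 this
    have c3 : 0.02 * k ^ 2 ≤ 0.001 * ((1 + β) * (α + β)) := by nlinarith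
    have c4 : 0 ≤ k ^ 2 * g ^ 2 := by positivity
    nlinarith
  have b2 : h ^ 2 * (α + β) * (0.999 * ((1 + β) * (α + β))) ≤
      h ^ 2 * (α + β) * ((1 + β + k ^ 2) * (α + β + g ^ 2) + 4 * β * k * g) :=
    mul_le_mul_of_nonneg_left b1 (by positivity)
  have hA : 0 < 1 + α := by linarith
  have hn : 0 < 1 + β := by linarith
  have b3 : (1 + α) * (1 + β) * (g ^ 2 * g ^ 2) ≤ (1 + α) * (1 + β) * (0.0201 * g ^ 2) :=
    mul_le_mul_of_nonneg_left (mul_le_mul_of_nonneg_right hg hg2) (by positivity)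
  have b4 : 0 ≤ (1 + α) * (α + β) * (k ^ 2 * g ^ 2) := by positivity
  refine lt_of_lt_of_le hf ?_
  -- The terms of order zero cancel, leaving second order and two quartic terms: `k ^ 2 * g ^ 2` is
  -- dropped, `g ^ 4` is bounded by `0.0201 * g ^ 2`.
  have e : h ^ 2 * (α + β) * ((1 + β + k ^ 2) * (α + β + g ^ 2) + 4 * β * k * g) +
      (1 + α) * ((α + β) ^ 2 * k ^ 2 + (1 + β) * g ^ 2 * (4 * β - (α + β)) +
        4 * β * (α + β) * k * g + (α + β) * (k ^ 2 * g ^ 2) - (1 + β) * (g ^ 2 * g ^ 2)) =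
      (1 + α + h ^ 2) * (α + β) * ((1 + β + k ^ 2) * (α + β + g ^ 2) + 4 * β * k * g) -
        (1 + α) * (1 + β) * ((α + β + g ^ 2) ^ 2 - 4 * β * g ^ 2) := by ring
  rw [← e]
  have e2 : g = h - k := hgdef
  have e3 : g ^ 2 = h ^ 2 - 2 * (h * k) + k ^ 2 := by rw [e2]; ring
  have e4 : k * g = h * k - k ^ 2 := by rw [e2]; ring
  have e5 : (1 + α) * ((α + β) ^ 2 * k ^ 2 + (1 + β) * g ^ 2 * (4 * β - (α + β)) +
        4 * β * (α + β) * k * g) = (1 + α) * ((α + β) ^ 2 * k ^ 2 +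
        (1 + β) * (h ^ 2 - 2 * (h * k) + k ^ 2) * (4 * β - (α + β)) +
        4 * β * (α + β) * (h * k - k ^ 2)) := by rw [← e3, ← e4]; ring
  have b3' : (1 + α) * (1 + β) * (0.0201 * g ^ 2) =
    (1 + α) * (1 + β) * (0.0201 * (h ^ 2 - 2 * (h * k) + k ^ 2)) := by rw [e3]
  linarith [b2, b3, b4, e5, b3']

theorem pole_coefficient_ge {β κ : ℝ} (h₁ : 0.4625 ≤ β) (h₂ : 0 ≤ κ) (h₃ : κ ≤ 0.0129) :
    8.2 ≤ (1 + β) * (2 / (1 + β) + 20 * β / (1 + β + κ) ^ 2) := by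
  have c1 : (1 + β) * (2 / (1 + β) + 20 * β / (1 + β + κ) ^ 2) =
      2 + 20 * β * (1 + β) / (1 + β + κ) ^ 2 := by
    have : 1 + β ≠ 0 := by linarith
    field_simp
  have c2 : 6.2 ≤ 20 * β * (1 + β) / (1 + β + κ) ^ 2 := by
    have : 0 < 1 + β + κ := by linarith
    rw [le_div_iff₀ (by positivity)]
    have : (1 + β + κ) ^ 2 ≤ (1 + β + 0.0129) ^ 2 := by gcongr
    nlinarith
  rw [c1]; linarith

/-- As `r ≤ 1`, the worst exponent is `8`; the bound is the tangent of `r ^ 8` at `3 / 4`, with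
`0.1001` just below `(3 / 4) ^ 8`. -/
theorem linear_le_rpow {r t : ℝ} (h₁ : 0.66 ≤ r) (h₂ : r ≤ 1) (ht : t ≤ 8) :
    0.1001 * (32 / 3 * r - 7) ≤ r ^ t := by
  have hr0 : 0 < r := by linarith
  have c1 : r ^ (8 : ℝ) ≤ r ^ t := Real.rpow_le_rpow_of_exponent_ge hr0 h₂ ht
  have c2 := tangent_le_rpow (t := 8) (x₀ := 0.75) (x := r) (by norm_num) (by norm_num) hr0.le
  have c3 : (0.75 : ℝ) ^ (8 : ℝ) = 6561 / 65536 := by norm_num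
  have c4 : r / 0.75 = 4 / 3 * r := by ring
  rw [c3, c4] at c2
  linarith

/-- The right side is `(α + β) ^ 2 + 2 * (α - β) * γ + γ ^ 2`, and `β - α` is at most `0.17`. -/
theorem side_denominator_ge {α β γ : ℝ} (h₁ : 0.66 ≤ α) (h₃ : 0.4625 ≤ β) (h₄ : β ≤ 0.83)
    (hγ : 0 ≤ γ) (hγ' : γ ≤ 0.0201) :
    0.99 * (α + β) ^ 2 ≤ (α + β + γ) ^ 2 - 4 * β * γ := by
  nlinarith

/-- Moving the horizontal pair down to the axis and centring the vertical pair
lowers the energy of the sides and of the bonds to the north pole. -/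
theorem vertical_step {t a b h k : ℝ} (ht : 6 ≤ t) (ht' : t ≤ 8) (h₁ : 0.66 ≤ a ^ 2)
    (h₂ : a ^ 2 ≤ 0.95) (h₃ : 0.4625 ≤ b ^ 2) (h₄ : b ^ 2 ≤ 0.83) (hg : (h - k) ^ 2 ≤ 0.0201)
    (hk2 : k ^ 2 ≤ 0.0129) (hk : h ≠ 0 ∨ k ≠ 0) :
    4 * ((1 + a ^ 2) * (1 + b ^ 2) / (a ^ 2 + b ^ 2)) ^ t + 2 * (1 + b ^ 2) ^ t <
      2 * (((1 + a ^ 2 + h ^ 2) * (1 + (b - k) ^ 2) / (a ^ 2 + (b + h - k) ^ 2)) ^ t +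
        ((1 + a ^ 2 + h ^ 2) * (1 + (b + k) ^ 2) / (a ^ 2 + (b - h + k) ^ 2)) ^ t) +
      ((1 + (b - k) ^ 2) ^ t + (1 + (b + k) ^ 2) ^ t) := by
  have hQ := side_numerator_pos h₁ h₂ h₃ h₄ hg hk2 hk
  have hpole := pole_pair_le (b := b) (k := k) ht
  have ha : 0 < a ^ 2 := by linarith
  have hb : 0 < b ^ 2 := by linarith
  have hd₁ : 0 < a ^ 2 + (b + h - k) ^ 2 := by positivity
  have hd₃ : 0 < a ^ 2 + (b - h + k) ^ 2 := by positivity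
  have hmean := two_mul_rpow_mean_le (t := t)
    (x := (1 + a ^ 2 + h ^ 2) * (1 + (b - k) ^ 2) / (a ^ 2 + (b + h - k) ^ 2))
    (y := (1 + a ^ 2 + h ^ 2) * (1 + (b + k) ^ 2) / (a ^ 2 + (b - h + k) ^ 2))
    (by linarith) (by positivity) (by positivity)
  set F := ((1 + a ^ 2 + h ^ 2) * (1 + (b - k) ^ 2) / (a ^ 2 + (b + h - k) ^ 2) +
    (1 + a ^ 2 + h ^ 2) * (1 + (b + k) ^ 2) / (a ^ 2 + (b - h + k) ^ 2)) / 2 with hF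
  have hF0 : 0 < F := by positivity
  set f₀ := (1 + a ^ 2) * (1 + b ^ 2) / (a ^ 2 + b ^ 2) with hf₀
  have hf₀0 : 0 < f₀ := by positivity
  have htan := tangent_le_rpow (t := t) (by linarith) hf₀0 hF0.le
  -- Ratio of the polar term `1 + b ^ 2` to the side term `f₀`; it puts both contributions on the
  -- common scale `f₀ ^ t`.
  set r := (a ^ 2 + b ^ 2) / (1 + a ^ 2) with hr
  have hr0 : 0 < r := by positivity
  have hr1 : r ≤ 1 := by rw [hr, div_le_one (by positivity)]; linarith
  have hnr : 1 + b ^ 2 = f₀ * r := by rw [hf₀, hr]; field_simp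
  -- lower bound for `r ^ t`
  have hρ : 0.1001 * (32 / 3 * r - 7) ≤ r ^ t := by
    exact linear_le_rpow (by rw [hr, le_div_iff₀ (by positivity)]; linarith) hr1 ht'
  have hρ0 : 0 ≤ 0.1001 * (32 / 3 * r - 7) := by
    have : 21 / 32 ≤ r := by rw [hr, le_div_iff₀ (by positivity)]; linarith
    linarith
  set C := 2 / (1 + b ^ 2) + 20 * b ^ 2 / (1 + b ^ 2 + k ^ 2) ^ 2 with hC
  have hC8 : 8.2 ≤ (1 + b ^ 2) * C := pole_coefficient_ge h₃ (sq_nonneg k) hk2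
  set Q := (1 + a ^ 2 + h ^ 2) * (a ^ 2 + b ^ 2) *
      ((1 + b ^ 2 + k ^ 2) * (a ^ 2 + b ^ 2 + (h - k) ^ 2) + 4 * b ^ 2 * k * (h - k)) -
    (1 + a ^ 2) * (1 + b ^ 2) * ((a ^ 2 + b ^ 2 + (h - k) ^ 2) ^ 2 - 4 * b ^ 2 * (h - k) ^ 2)
    with hQdef
  have hden : (a ^ 2 + b ^ 2 + (h - k) ^ 2) ^ 2 - 4 * b ^ 2 * (h - k) ^ 2 =
      (a ^ 2 + (b + h - k) ^ 2) * (a ^ 2 + (b - h + k) ^ 2) := by ring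
  set den := (a ^ 2 + b ^ 2 + (h - k) ^ 2) ^ 2 - 4 * b ^ 2 * (h - k) ^ 2 with hdendef
  have hden0 : 0 < den := by rw [hden]; positivity
  have hden1 : 0.99 * (a ^ 2 + b ^ 2) ^ 2 ≤ den :=
    side_denominator_ge h₁ h₃ h₄ (sq_nonneg _) hg
  have hFQ : F / f₀ - 1 = Q / ((1 + a ^ 2) * (1 + b ^ 2) * den) := by
    have c1 : F = (1 + a ^ 2 + h ^ 2) *
        ((1 + b ^ 2 + k ^ 2) * (a ^ 2 + b ^ 2 + (h - k) ^ 2) + 4 * b ^ 2 * k * (h - k)) / den := by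
      rw [hF, hden]
      field_simp
      ring
    rw [c1, hf₀, hQdef]
    field_simp
  -- the two contributions together are positive
  have hpos : 0 < 4 * (F / f₀ - 1) + r ^ t * (k ^ 2 * C) := by
    have hX : 0 < (1 + a ^ 2) * (1 + b ^ 2) * den := by positivity
    have c1 : 0.99 * 0.1001 * (a ^ 2 + b ^ 2) ^ 2 *
        (32 / 3 * (a ^ 2 + b ^ 2) - 7 * (1 + a ^ 2)) * 8.2 * k ^ 2 ≤
        (1 + a ^ 2) * (1 + b ^ 2) * den * (r ^ t * (k ^ 2 * C)) := by
      have e1 : 0.99 * 0.1001 * (a ^ 2 + b ^ 2) ^ 2 *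
          (32 / 3 * (a ^ 2 + b ^ 2) - 7 * (1 + a ^ 2)) * 8.2 * k ^ 2 =
          (1 + a ^ 2) * k ^ 2 * ((0.99 * (a ^ 2 + b ^ 2) ^ 2) *
            (0.1001 * (32 / 3 * r - 7)) * 8.2) := by
        rw [hr]; field_simp
      have e2 : (1 + a ^ 2) * (1 + b ^ 2) * den * (r ^ t * (k ^ 2 * C)) =
          (1 + a ^ 2) * k ^ 2 * (den * r ^ t * ((1 + b ^ 2) * C)) := by ring
      rw [e1, e2]
      gcongr
    have c2 : 0 < ((1 + a ^ 2) * (1 + b ^ 2) * den) *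
        (4 * (F / f₀ - 1) + r ^ t * (k ^ 2 * C)) := by
      have : ((1 + a ^ 2) * (1 + b ^ 2) * den) * (F / f₀ - 1) = Q := by
        rw [hFQ]; field_simp
      linarith
    exact (mul_pos_iff_of_pos_left hX).1 c2
  have hnt : (1 + b ^ 2) ^ t = f₀ ^ t * r ^ t := by
    rw [hnr, Real.mul_rpow hf₀0.le hr0.le]
  have hft : 0 < f₀ ^ t * t := by positivity
  have hfin := mul_pos hft hpos
  have e : (1 + b ^ 2) ^ t * (2 + t * k ^ 2 * C) =
      2 * (1 + b ^ 2) ^ t + f₀ ^ t * t * (r ^ t * (k ^ 2 * C)) := by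
    rw [hnt]; ring
  rw [e] at hpole
  linarith

/-! ### The horizontal move: `u`, `x₁` and `x₃` to zero. -/

theorem horizontal_pair_eq (a u h : ℝ) :
    (1 + (a + u) ^ 2 + h ^ 2) * (1 + (a - u) ^ 2 + h ^ 2) =
      (1 + a ^ 2 + h ^ 2) ^ 2 + (2 * (1 - a ^ 2 + h ^ 2) * u ^ 2 + u ^ 4) := by
  ring

theorem horizontal_pair_ge {a u h : ℝ} :
    (1 + a ^ 2 + h ^ 2) ^ 2 + 2 * (1 - a ^ 2) * u ^ 2 ≤
      (1 + (a + u) ^ 2 + h ^ 2) * (1 + (a - u) ^ 2 + h ^ 2) := by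
  rw [horizontal_pair_eq]
  have : 0 ≤ u ^ 4 := by positivity
  have : 0 ≤ h ^ 2 * u ^ 2 := by positivity
  linarith

/-- The gain `2 * (1 - a ^ 2) * u ^ 2` from `horizontal_pair_ge` covers the share `1.22 * u ^ 2` of
the loss in `side_pair_ge`; `vertical_weight_le` does the same for `5.55 * x ^ 2`. -/
theorem horizontal_weight_le {α υ η : ℝ} (h₁ : 0.6617 ≤ α) (h₂ : α ≤ 0.95) (h₃ : υ ≤ 0.876)
    (h₄ : 0 ≤ υ) (hη : 0 ≤ η) (hη' : η ≤ 0.0008) (hp : 0 ≤ υ - α + 0.012) :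
    1.22 * (υ - α + 0.012) * (1 + α + η) ^ 2 ≤ (1 - α) * (α + υ) ^ 2 := by
  have c1 : 1.22 * (υ - α + 0.012) * (1 + α + η) ^ 2 ≤
      1.22 * (υ - α + 0.012) * (1 + α + 0.0008) ^ 2 := by gcongr
  refine c1.trans ?_
  obtain ⟨p, rfl⟩ : ∃ p, α = 0.6617 + p := ⟨α - 0.6617, by ring⟩
  obtain ⟨q, rfl⟩ : ∃ q, υ = 0.876 - q := ⟨0.876 - υ, by ring⟩
  have hp0 : 0 ≤ p := by linarith
  have hq0 : 0 ≤ q := by linarith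
  nlinarith [mul_nonneg hp0 hq0, mul_nonneg (mul_nonneg hp0 hq0) hp0,
    mul_nonneg (mul_nonneg hp0 hq0) hq0, mul_nonneg hp0 hp0]

theorem vertical_weight_le {α υ y : ℝ} (h₁ : 0.6617 ≤ α) (h₃ : υ ≤ 0.876)
    (h₄ : 0 ≤ υ) (hy' : y ≤ 0.8235) (hp : 0 ≤ υ - α + 0.012) :
    5.55 * (υ - α + 0.012) * (1 + y) ≤ (α + υ) ^ 2 := by
  have c1 : 5.55 * (υ - α + 0.012) * (1 + y) ≤ 5.55 * (υ - α + 0.012) * (1 + 0.8235) := by gcongr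
  nlinarith

/-- The product of the two side terms at a vertex of the vertical pair decreases when the
horizontal pair and that vertex are centred. -/
theorem side_pair_ge {a u h x y v : ℝ} (h₁ : 0.6617 ≤ a ^ 2) (h₂ : a ^ 2 ≤ 0.95)
    (hv : v ^ 2 ≤ 0.876) (hy : y ^ 2 ≤ 0.8235) (hh : h ^ 2 ≤ 0.0008)
    (he : (u - x) ^ 2 ≤ 0.024) :
    (1 + a ^ 2 + h ^ 2) ^ 2 * (1 + y ^ 2) ^ 2 *
        (((a + u - x) ^ 2 + v ^ 2) * ((a - u + x) ^ 2 + v ^ 2)) ≤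
      (1 + (a + u) ^ 2 + h ^ 2) * (1 + (a - u) ^ 2 + h ^ 2) * (1 + x ^ 2 + y ^ 2) ^ 2 *
        (a ^ 2 + v ^ 2) ^ 2 := by
  have hA := horizontal_pair_ge (a := a) (u := u) (h := h)
  have hB : (1 + y ^ 2) ^ 2 + 2 * (1 + y ^ 2) * x ^ 2 ≤ (1 + x ^ 2 + y ^ 2) ^ 2 := by
    nlinarith [sq_nonneg (x ^ 2)]
  have hprod : ((1 + a ^ 2 + h ^ 2) ^ 2 + 2 * (1 - a ^ 2) * u ^ 2) *
      ((1 + y ^ 2) ^ 2 + 2 * (1 + y ^ 2) * x ^ 2) ≤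
      (1 + (a + u) ^ 2 + h ^ 2) * (1 + (a - u) ^ 2 + h ^ 2) * (1 + x ^ 2 + y ^ 2) ^ 2 := by
    have : 0 ≤ 1 - a ^ 2 := by linarith
    gcongr
  refine le_trans ?_ (mul_le_mul_of_nonneg_right hprod (by positivity))
  -- With `e = u - x`, the quartic term obeys `e ^ 4 ≤ 0.024 * e ^ 2`, whence `0.012` inside the
  -- doubled bracket.
  have hd : ((a + u - x) ^ 2 + v ^ 2) * ((a - u + x) ^ 2 + v ^ 2) ≤
      (a ^ 2 + v ^ 2) ^ 2 + 2 * (v ^ 2 - a ^ 2 + 0.012) * (u - x) ^ 2 := by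
    nlinarith [sq_nonneg (u - x)]
  have hn : 0 ≤ (1 + a ^ 2 + h ^ 2) ^ 2 * (1 + y ^ 2) ^ 2 := by positivity
  refine (mul_le_mul_of_nonneg_left hd hn).trans ?_
  have hcross : 0 ≤ 2 * (1 - a ^ 2) * u ^ 2 * (2 * (1 + y ^ 2) * x ^ 2) * (a ^ 2 + v ^ 2) ^ 2 := by
    have : 0 ≤ 1 - a ^ 2 := by linarith
    positivity
  have hu : 0 ≤ 1 - a ^ 2 := by linarith
  rcases le_or_gt 0 (v ^ 2 - a ^ 2 + 0.012) with hp | hp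
  · have w₁ := horizontal_weight_le h₁ h₂ hv (sq_nonneg v) (sq_nonneg h) hh hp
    have w₂ := vertical_weight_le h₁ hv (sq_nonneg v) hy hp
    -- A weighted Cauchy-Schwarz bound, valid because `1 / 1.22 + 1 / 5.55 ≤ 1`.
    have hsplit : (u - x) ^ 2 ≤ 1.22 * u ^ 2 + 5.55 * x ^ 2 := by
      nlinarith [sq_nonneg (0.22 * u + x)]
    have c1 := mul_le_mul_of_nonneg_left hsplit
      (by positivity : 0 ≤ (1 + a ^ 2 + h ^ 2) ^ 2 * (1 + y ^ 2) ^ 2 *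
        (2 * (v ^ 2 - a ^ 2 + 0.012)))
    have c2 := mul_le_mul_of_nonneg_left w₁
      (by positivity : 0 ≤ 2 * (1 + y ^ 2) ^ 2 * u ^ 2)
    have c3 := mul_le_mul_of_nonneg_left w₂
      (by positivity : 0 ≤ 2 * (1 + a ^ 2 + h ^ 2) ^ 2 * (1 + y ^ 2) * x ^ 2)
    linarith
  · have c1 : (1 + a ^ 2 + h ^ 2) ^ 2 * (1 + y ^ 2) ^ 2 *
        (2 * (v ^ 2 - a ^ 2 + 0.012) * (u - x) ^ 2) ≤ 0 := by
      apply mul_nonpos_of_nonneg_of_nonpos hn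
      nlinarith [sq_nonneg (u - x)]
    have c2 : 0 ≤ 2 * (1 - a ^ 2) * u ^ 2 * (1 + y ^ 2) ^ 2 * (a ^ 2 + v ^ 2) ^ 2 := by positivity
    have c3 : 0 ≤ (1 + a ^ 2 + h ^ 2) ^ 2 * (2 * (1 + y ^ 2) * x ^ 2) * (a ^ 2 + v ^ 2) ^ 2 := by
      positivity
    linarith

theorem side_pair_rpow_ge {t a u h x y v : ℝ} (ht : 0 ≤ t) (h₁ : 0.6617 ≤ a ^ 2)
    (h₂ : a ^ 2 ≤ 0.95) (hv : v ^ 2 ≤ 0.876) (hy : y ^ 2 ≤ 0.8235) (hh : h ^ 2 ≤ 0.0008)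
    (he : (u - x) ^ 2 ≤ 0.024) (hv0 : v ≠ 0) :
    2 * ((1 + a ^ 2 + h ^ 2) * (1 + y ^ 2) / (a ^ 2 + v ^ 2)) ^ t ≤
      ((1 + (a + u) ^ 2 + h ^ 2) * (1 + x ^ 2 + y ^ 2) / ((a + u - x) ^ 2 + v ^ 2)) ^ t +
      ((1 + (a - u) ^ 2 + h ^ 2) * (1 + x ^ 2 + y ^ 2) / ((a - u + x) ^ 2 + v ^ 2)) ^ t := by
  apply two_mul_rpow_le_add ht (by positivity) (by positivity) (by positivity)
  rw [div_pow, div_mul_div_comm, div_le_div_iff₀ (by positivity) (by positivity)]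
  have := side_pair_ge h₁ h₂ hv hy hh he
  linarith

/-- The tangent bound gives each polar bond a gain `t * B ^ t / B * x ^ 2`. Half of it covers the
loss of the diagonal, which is small because `G` is at most `0.8 * B`; the other half stays in the
statement to give strictness. -/
theorem diagonal_le {t c B₁ B₃ x₁ x₃ : ℝ} (ht : 6 ≤ t) (hc : 0 < c) (hB₁ : 0 < B₁)
    (hB₃ : 0 < B₃) (h₁ : B₁ ≤ 0.8 * c) (h₃ : B₃ ≤ 0.8 * c)  :
    B₁ ^ t + B₃ ^ t + (B₁ * B₃ / c) ^ t + t / 2 * (B₁ ^ t / B₁ * x₁ ^ 2 + B₃ ^ t / B₃ * x₃ ^ 2) ≤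
      (B₁ + x₁ ^ 2) ^ t + (B₃ + x₃ ^ 2) ^ t +
        ((B₁ + x₁ ^ 2) * (B₃ + x₃ ^ 2) / ((x₁ - x₃) ^ 2 + c)) ^ t := by
  have tan : ∀ B x : ℝ, 0 < B → B ^ t + t * (B ^ t / B * x ^ 2) ≤ (B + x ^ 2) ^ t := by
    intro B x hB
    have := tangent_le_rpow (t := t) (x := B + x ^ 2) (by linarith) hB (by positivity)
    refine le_trans (le_of_eq ?_) this
    field_simp
    ring
  have t₁ := tan B₁ x₁ hB₁
  have t₃ := tan B₃ x₃ hB₃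
  set G := B₁ * B₃ / c with hG
  have hG0 : 0 < G := by positivity
  set f := (B₁ + x₁ ^ 2) * (B₃ + x₃ ^ 2) / ((x₁ - x₃) ^ 2 + c) with hf
  have hf0 : 0 < f := by positivity
  have tf := tangent_le_rpow (t := t) (by linarith) hG0 hf0.le
  have hfG : -(2 * (x₁ ^ 2 + x₃ ^ 2) / c) ≤ f / G - 1 := by
    have c1 : B₁ * B₃ / (2 * (x₁ ^ 2 + x₃ ^ 2) + c) ≤ f := by
      rw [hf]
      have : (x₁ - x₃) ^ 2 ≤ 2 * (x₁ ^ 2 + x₃ ^ 2) := by nlinarith [sq_nonneg (x₁ + x₃)]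
      gcongr
      · nlinarith [sq_nonneg x₁]
      · nlinarith [sq_nonneg x₃]
    have c2 : c / (2 * (x₁ ^ 2 + x₃ ^ 2) + c) ≤ f / G := by
      rw [le_div_iff₀ hG0]
      refine le_trans (le_of_eq ?_) c1
      rw [hG]; field_simp
    have c3 : 1 - 2 * (x₁ ^ 2 + x₃ ^ 2) / c ≤ c / (2 * (x₁ ^ 2 + x₃ ^ 2) + c) := by
      have e : 1 - 2 * (x₁ ^ 2 + x₃ ^ 2) / c = (c - 2 * (x₁ ^ 2 + x₃ ^ 2)) / c := by field_simp
      rw [e, div_le_div_iff₀ hc (by positivity)]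
      nlinarith [sq_nonneg (2 * (x₁ ^ 2 + x₃ ^ 2))]
    linarith
  -- The constants fit since `0.8 ^ 6 ≤ 0.3` and `4 * 0.3 * 0.8 < 1`.
  have hpow : ∀ B : ℝ, 0 < B → B ≤ 0.8 * c → G ≤ 0.8 * B → 4 * G ^ t / c ≤ B ^ t / B := by
    intro B hB hBc hGB
    have c1 : G ^ t ≤ (0.8 : ℝ) ^ t * B ^ t := by
      rw [← Real.mul_rpow (by norm_num) hB.le]
      exact Real.rpow_le_rpow hG0.le hGB (by linarith)
    have c2 : (0.8 : ℝ) ^ t ≤ 0.8 ^ (6 : ℝ) :=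
      Real.rpow_le_rpow_of_exponent_ge (by norm_num) (by norm_num) ht
    have c3 : (0.8 : ℝ) ^ (6 : ℝ) ≤ 0.3 := by norm_num
    have hBt : 0 < B ^ t := by positivity
    rw [div_le_div_iff₀ hc hB]
    have c4 : G ^ t ≤ 0.3 * B ^ t :=
      c1.trans (mul_le_mul_of_nonneg_right (c2.trans c3) hBt.le)
    calc 4 * G ^ t * B ≤ 4 * (0.3 * B ^ t) * (0.8 * c) := by gcongr
      _ ≤ B ^ t * c := by
        have : 0 < B ^ t * c := by positivity
        linarith
  have p₁ := hpow B₁ hB₁ h₁ (by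
    rw [hG, div_le_iff₀ hc]
    nlinarith)
  have p₃ := hpow B₃ hB₃ h₃ (by
    rw [hG, div_le_iff₀ hc]
    nlinarith)
  have q₁ := mul_le_mul_of_nonneg_right p₁ (sq_nonneg x₁)
  have q₃ := mul_le_mul_of_nonneg_right p₃ (sq_nonneg x₃)
  have hGt : 0 < G ^ t := by positivity
  have s₁ : G ^ t * (1 + t * -(2 * (x₁ ^ 2 + x₃ ^ 2) / c)) ≤ f ^ t := by
    refine le_trans ?_ tf
    gcongr
  have e : G ^ t * (1 + t * -(2 * (x₁ ^ 2 + x₃ ^ 2) / c)) =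
      G ^ t - t / 2 * (4 * G ^ t / c * x₁ ^ 2 + 4 * G ^ t / c * x₃ ^ 2) := by ring
  have s₂ : t / 2 * (4 * G ^ t / c * x₁ ^ 2 + 4 * G ^ t / c * x₃ ^ 2) ≤
      t / 2 * (B₁ ^ t / B₁ * x₁ ^ 2 + B₃ ^ t / B₃ * x₃ ^ 2) := by
    gcongr
  linarith

/-! ### Combining the two moves. -/

theorem energy_lt {t a b u h k x₁ x₃ : ℝ} (ht : 6 ≤ t) (ht' : t ≤ 8) (ha : 0.6617 ≤ a ^ 2)
    (ha' : a ^ 2 ≤ 0.95) (hb : 0.4625 ≤ b ^ 2) (hb' : b ^ 2 ≤ 0.83) (hh : h ^ 2 ≤ 0.0008)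
    (hk : k ^ 2 ≤ 0.0129) (hg : (h - k) ^ 2 ≤ 0.0201) (he₁ : (u - x₁) ^ 2 ≤ 0.024)
    (he₃ : (u - x₃) ^ 2 ≤ 0.024) (hy₁ : (b - k) ^ 2 ≤ 0.8235) (hy₃ : (b + k) ^ 2 ≤ 0.8235)
    (hv₁ : (b + h - k) ^ 2 ≤ 0.876) (hv₃ : (b - h + k) ^ 2 ≤ 0.876) (hv₁' : b + h - k ≠ 0)
    (hv₃' : b - h + k ≠ 0) (hB₁ : 1 + (b - k) ^ 2 ≤ 3.2 * b ^ 2)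
    (hB₃ : 1 + (b + k) ^ 2 ≤ 3.2 * b ^ 2)
    (hne : u ≠ 0 ∨ h ≠ 0 ∨ k ≠ 0 ∨ x₁ ≠ 0 ∨ x₃ ≠ 0) :
    2 * (1 + a ^ 2) ^ t + 2 * (1 + b ^ 2) ^ t + ((1 + a ^ 2) ^ 2 / (4 * a ^ 2)) ^ t +
        ((1 + b ^ 2) ^ 2 / (4 * b ^ 2)) ^ t +
        4 * ((1 + a ^ 2) * (1 + b ^ 2) / (a ^ 2 + b ^ 2)) ^ t <
      (1 + (a + u) ^ 2 + h ^ 2) ^ t + (1 + (a - u) ^ 2 + h ^ 2) ^ t +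
        (1 + x₁ ^ 2 + (b - k) ^ 2) ^ t + (1 + x₃ ^ 2 + (b + k) ^ 2) ^ t +
        ((1 + (a + u) ^ 2 + h ^ 2) * (1 + (a - u) ^ 2 + h ^ 2) / (4 * a ^ 2)) ^ t +
        ((1 + x₁ ^ 2 + (b - k) ^ 2) * (1 + x₃ ^ 2 + (b + k) ^ 2) /
          ((x₁ - x₃) ^ 2 + 4 * b ^ 2)) ^ t +
        ((1 + (a + u) ^ 2 + h ^ 2) * (1 + x₁ ^ 2 + (b - k) ^ 2) /
          ((a + u - x₁) ^ 2 + (b + h - k) ^ 2)) ^ t +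
        ((1 + (a - u) ^ 2 + h ^ 2) * (1 + x₁ ^ 2 + (b - k) ^ 2) /
          ((a - u + x₁) ^ 2 + (b + h - k) ^ 2)) ^ t +
        ((1 + (a + u) ^ 2 + h ^ 2) * (1 + x₃ ^ 2 + (b + k) ^ 2) /
          ((a + u - x₃) ^ 2 + (b - h + k) ^ 2)) ^ t +
        ((1 + (a - u) ^ 2 + h ^ 2) * (1 + x₃ ^ 2 + (b + k) ^ 2) /
          ((a - u + x₃) ^ 2 + (b - h + k) ^ 2)) ^ t := by
  have ht0 : 0 < t := by linarith
  have hb0 : 0 < b ^ 2 := by linarith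
  have ha0 : 0 < a ^ 2 := by linarith
  have hprod := horizontal_pair_ge (a := a) (u := u) (h := h)
  have hu2 : 0 ≤ 2 * (1 - a ^ 2) * u ^ 2 :=
    mul_nonneg (by linarith) (sq_nonneg u)
  -- the bonds of the horizontal pair to the north pole
  have s₁ : 2 * (1 + a ^ 2 + h ^ 2) ^ t ≤
      (1 + (a + u) ^ 2 + h ^ 2) ^ t + (1 + (a - u) ^ 2 + h ^ 2) ^ t :=
    two_mul_rpow_le_add ht0.le (by positivity) (by positivity) (by positivity) (by linarith)
  have s₁' : u ≠ 0 → 2 * (1 + a ^ 2 + h ^ 2) ^ t <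
      (1 + (a + u) ^ 2 + h ^ 2) ^ t + (1 + (a - u) ^ 2 + h ^ 2) ^ t := by
    intro hu
    have : 0 < 2 * (1 - a ^ 2) * u ^ 2 := mul_pos (by linarith) (by positivity)
    exact two_mul_rpow_lt_add ht0 (by positivity) (by positivity) (by positivity) (by linarith)
  have s₂ : (1 + a ^ 2) ^ t ≤ (1 + a ^ 2 + h ^ 2) ^ t :=
    Real.rpow_le_rpow (by positivity) (by nlinarith [sq_nonneg h]) ht0.le
  -- the horizontal diagonal
  have s₃ : ((1 + a ^ 2) ^ 2 / (4 * a ^ 2)) ^ t ≤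
      ((1 + (a + u) ^ 2 + h ^ 2) * (1 + (a - u) ^ 2 + h ^ 2) / (4 * a ^ 2)) ^ t := by
    apply Real.rpow_le_rpow (by positivity) _ ht0.le
    have : (1 + a ^ 2) ^ 2 ≤ (1 + a ^ 2 + h ^ 2) ^ 2 := by
      have := sq_nonneg h
      exact pow_le_pow_left₀ (by positivity) (by linarith) 2
    gcongr
    linarith
  -- the vertical pair
  have s₄ := diagonal_le (x₁ := x₁) (x₃ := x₃) ht (by positivity : 0 < 4 * b ^ 2)
    (by positivity : 0 < 1 + (b - k) ^ 2) (by positivity : 0 < 1 + (b + k) ^ 2)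
    (by linarith) (by linarith)
  rw [show 1 + (b - k) ^ 2 + x₁ ^ 2 = 1 + x₁ ^ 2 + (b - k) ^ 2 by ring,
    show 1 + (b + k) ^ 2 + x₃ ^ 2 = 1 + x₃ ^ 2 + (b + k) ^ 2 by ring] at s₄
  have w₁ : 0 < (1 + (b - k) ^ 2) ^ t / (1 + (b - k) ^ 2) := by positivity
  have w₃ : 0 < (1 + (b + k) ^ 2) ^ t / (1 + (b + k) ^ 2) := by positivity
  have q₁ := mul_nonneg w₁.le (sq_nonneg x₁)
  have q₃ := mul_nonneg w₃.le (sq_nonneg x₃)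
  have s₅ : ((1 + b ^ 2) ^ 2 / (4 * b ^ 2)) ^ t ≤
      ((1 + (b - k) ^ 2) * (1 + (b + k) ^ 2) / (4 * b ^ 2)) ^ t := by
    apply Real.rpow_le_rpow (by positivity) _ ht0.le
    gcongr
    have c₁ := horizontal_pair_ge (a := b) (u := k) (h := 0)
    have c₂ : 0 ≤ 2 * (1 - b ^ 2) * k ^ 2 := mul_nonneg (by linarith) (sq_nonneg k)
    linarith
  -- the sides
  have s₆ := side_pair_rpow_ge (y := b - k) ht0.le ha ha' hv₁ hy₁ hh he₁ hv₁'
  have s₇ := side_pair_rpow_ge (y := b + k) ht0.le ha ha' hv₃ hy₃ hh he₃ hv₃'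
  have hqt : 0 ≤ t / 2 * ((1 + (b - k) ^ 2) ^ t / (1 + (b - k) ^ 2) * x₁ ^ 2 +
      (1 + (b + k) ^ 2) ^ t / (1 + (b + k) ^ 2) * x₃ ^ 2) := by positivity
  by_cases hhk : h ≠ 0 ∨ k ≠ 0
  · have s₈ := vertical_step ht ht' (by linarith) ha' hb hb' hg hk hhk
    linarith
  · push Not at hhk
    obtain ⟨rfl, rfl⟩ := hhk
    have z : (0 : ℝ) ^ 2 = 0 := by norm_num
    simp only [add_zero, sub_zero, z] at s₁ s₁' s₃ s₄ s₅ s₆ s₇ hqt ⊢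
    -- With `h = k = 0`, strictness comes from the polar bonds: of the horizontal pair if `u ≠ 0`,
    -- otherwise from the half gain kept in `diagonal_le`.
    by_cases hu : u = 0
    · have hx : x₁ ≠ 0 ∨ x₃ ≠ 0 := by simpa [hu] using hne
      have : 0 < t / 2 * ((1 + b ^ 2) ^ t / (1 + b ^ 2) * x₁ ^ 2 +
          (1 + b ^ 2) ^ t / (1 + b ^ 2) * x₃ ^ 2) := by
        rcases hx with hx | hx <;> positivity
      linarith
    · have := s₁' hu
      linarith

/-! ### The energy in stereographic coordinates. -/

/-- One plus the squared distance to the origin. -/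
noncomputable def height (p : Plane) : ℝ := 1 + p 0 ^ 2 + p 1 ^ 2

/-- Four times the inverse squared distance of the points with stereographic
coordinates `p` and `q`. -/
noncomputable def bond (p q : Plane) : ℝ := height p * height q / ((p 0 - q 0) ^ 2 + (p 1 - q 1) ^ 2)

/-- `2 ^ s` times the `R_s`-energy, as a function of `t = s / 2`. -/
noncomputable def scaledEnergy (t : ℝ) (X : Fin 4 → Plane) : ℝ :=
  height (X 0) ^ t + height (X 2) ^ t + height (X 1) ^ t + height (X 3) ^ t +
    bond (X 0) (X 2) ^ t + bond (X 1) (X 3) ^ t + bond (X 0) (X 1) ^ t + bond (X 2) (X 1) ^ t +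
    bond (X 0) (X 3) ^ t + bond (X 2) (X 3) ^ t

theorem height_pos (p : Plane) : 0 < height p := by unfold height; positivity

theorem bond_nonneg (p q : Plane) : 0 ≤ bond p q := by
  have := height_pos p
  have := height_pos q
  unfold bond
  positivity

theorem bond_comm (p q : Plane) : bond p q = bond q p := by
  unfold bond
  rw [mul_comm]
  congr 1
  ring

theorem norm_sq_sub_invStereo (p q : Plane) :
    ‖invStereo p - invStereo q‖ ^ 2 = 4 * (bond p q)⁻¹ := by
  have hp := (height_pos p).ne'
  have hq := (height_pos q).ne'
  unfold bond
  rw [EuclideanSpace.norm_sq_eq]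
  simp only [Fin.sum_univ_three, Real.norm_eq_abs, sq_abs, invStereo]
  unfold height at *
  simp
  field_simp
  ring

theorem norm_sq_invStereo_sub_northPole (p : Plane) :
    ‖invStereo p - northPole‖ ^ 2 = 4 * (height p)⁻¹ := by
  have hp := (height_pos p).ne'
  rw [EuclideanSpace.norm_sq_eq]
  simp only [Fin.sum_univ_three, Real.norm_eq_abs, sq_abs, invStereo, northPole]
  unfold height at *
  simp
  field_simp
  ring

theorem powerLaw_norm {s c : ℝ} (hs : 0 < s) (hc : 0 ≤ c) {v : Space}
    (hv : ‖v‖ ^ 2 = 4 * c⁻¹) : powerLaw s ‖v‖ = (4 : ℝ) ^ (-(s / 2)) * c ^ (s / 2) := by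
  have e : ‖v‖ ^ (-s) = (‖v‖ ^ 2) ^ (-(s / 2)) := by
    rw [← Real.rpow_natCast, ← Real.rpow_mul (norm_nonneg v)]
    congr 1
    push_cast
    ring
  rw [powerLaw, Real.sign_of_pos hs, one_mul, e, hv, Real.mul_rpow (by norm_num) (by positivity)]
  congr 1
  rw [Real.inv_rpow hc, Real.rpow_neg hc, inv_inv]

theorem rieszEnergy_eq {s : ℝ} (hs : 0 < s) (X : Fin 4 → Plane) :
    rieszEnergy s X = (4 : ℝ) ^ (-(s / 2)) * scaledEnergy (s / 2) X := by
  have hb : ∀ p q, powerLaw s ‖invStereo p - invStereo q‖ =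
      (4 : ℝ) ^ (-(s / 2)) * bond p q ^ (s / 2) := fun p q =>
    powerLaw_norm hs (bond_nonneg p q) (norm_sq_sub_invStereo p q)
  have hn : ∀ p, powerLaw s ‖invStereo p - northPole‖ =
      (4 : ℝ) ^ (-(s / 2)) * height p ^ (s / 2) := fun p =>
    powerLaw_norm hs (height_pos p).le (norm_sq_invStereo_sub_northPole p)
  have i0 : Finset.Ioi (0 : Fin 5) = {1, 2, 3, 4} := by decide
  have i1 : Finset.Ioi (1 : Fin 5) = {2, 3, 4} := by decide
  have i2 : Finset.Ioi (2 : Fin 5) = {3, 4} := by decide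
  have i3 : Finset.Ioi (3 : Fin 5) = {4} := by decide
  have i4 : Finset.Ioi (4 : Fin 5) = ∅ := by decide
  have c0 : configuration X 0 = invStereo (X 0) := rfl
  have c1 : configuration X 1 = invStereo (X 1) := rfl
  have c2 : configuration X 2 = invStereo (X 2) := rfl
  have c3 : configuration X 3 = invStereo (X 3) := rfl
  have c4 : configuration X 4 = northPole := rfl
  rw [rieszEnergy, potential, Fin.sum_univ_five, i0, i1, i2, i3, i4]
  simp [c0, c1, c2, c3, c4, hb, hn]
  rw [scaledEnergy, bond_comm (X 2) (X 1)]
  ring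

/-! ### Rotation invariance and bounds on the aligned configuration. -/

theorem height_rotate (θ : ℝ) (p : Plane) : height (rotate θ p) = height p := by
  simp only [height, rotate]
  simp
  linear_combination (p 0 ^ 2 + p 1 ^ 2) * Real.sin_sq_add_cos_sq θ

theorem bond_rotate (θ : ℝ) (p q : Plane) : bond (rotate θ p) (rotate θ q) = bond p q := by
  rw [bond, bond, height_rotate, height_rotate]
  congr 1
  simp only [rotate]
  simp
  linear_combination ((p 0 - q 0) ^ 2 + (p 1 - q 1) ^ 2) * Real.sin_sq_add_cos_sq θ

theorem scaledEnergy_align (t : ℝ) (X : Fin 4 → Plane) :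
    scaledEnergy t (align X) = scaledEnergy t X := by
  simp only [scaledEnergy, align, height_rotate, bond_rotate]

/-- The angle aligning the horizontal pair is small for configurations in `SMALL`. -/
theorem cos_sin_alignAngle {X : Fin 4 → Plane} (hX : X ∈ SMALL) :
    0 ≤ Real.sin (alignAngle X) ∧ 833 * Real.sin (alignAngle X) ≤ 24 ∧
      0.9995 ≤ Real.cos (alignAngle X) ∧ Real.cos (alignAngle X) ≤ 1 ∧
      Real.sin (alignAngle X) * X 0 0 =
        Real.sin (alignAngle X) * X 2 0 + Real.cos (alignAngle X) * X 2 1 := by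
  obtain ⟨-, ⟨⟨hx0, hx0'⟩, hy0⟩, -, ⟨⟨hx2, hx2'⟩, hy2, hy2'⟩, -⟩ := hX
  have hne : X 0 ≠ X 2 := by
    intro h
    rw [h] at hx0
    linarith
  obtain ⟨h1, h2⟩ := (align_iff X hne (alignAngle X)).2 rfl
  have hcs := Real.sin_sq_add_cos_sq (alignAngle X)
  have hc1 := Real.cos_le_one (alignAngle X)
  set c := Real.cos (alignAngle X)
  set σ := Real.sin (alignAngle X)
  simp only [rotate] at h1 h2
  simp [hy0] at h1 h2
  have hx : 833 ≤ 512 * (X 0 0 - X 2 0) := by linarith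
  have hpos : 0 < X 0 0 - X 2 0 := by linarith
  have hσ : σ * (X 0 0 - X 2 0) = c * X 2 1 := by linarith
  have hc : 0 < c := by
    have e : c * ((X 0 0 - X 2 0) ^ 2 + X 2 1 ^ 2) =
        (c * (X 0 0 - X 2 0) + σ * X 2 1) * (X 0 0 - X 2 0) := by
      linear_combination -(X 2 1) * hσ
    have : 0 < c * ((X 0 0 - X 2 0) ^ 2 + X 2 1 ^ 2) := by
      rw [e]
      exact mul_pos (by linarith) hpos
    exact (mul_pos_iff_of_pos_right (by positivity)).1 this
  have hσ0 : 0 ≤ σ := by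
    have : 0 ≤ σ * (X 0 0 - X 2 0) := by
      rw [hσ]
      exact mul_nonneg hc.le (by linarith)
    exact (mul_nonneg_iff_of_pos_right hpos).1 this
  have hσ1 : 833 * σ ≤ 24 := by
    have c1 : σ * 833 ≤ σ * (512 * (X 0 0 - X 2 0)) := mul_le_mul_of_nonneg_left hx hσ0
    have c2 : c * (512 * X 2 1) ≤ 1 * 24 := mul_le_mul hc1 hy2' (by linarith) (by norm_num)
    linarith
  refine ⟨hσ0, hσ1, ?_, hc1, h1⟩
  nlinarith

theorem align_bounds {X : Fin 4 → Plane} (hX : X ∈ SMALL) :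
    align X 0 0 - align X 2 0 ∈ Set.Ioi 0 ∧
    (align X 0 0 - align X 2 0) ^ 2 ∈ Set.Icc 2.6468 3.8 ∧
    align X 0 0 + align X 2 0 ∈ Set.Icc (-0.13) 0.1916 ∧
    align X 2 1 = align X 0 1 ∧ align X 0 1 ∈ Set.Icc 0 0.0281 ∧
    align X 1 0 ∈ Set.Icc (-0.0313) 0.0574 ∧ align X 1 1 ∈ Set.Icc (-0.9072) (-0.6803) ∧
    align X 3 0 ∈ Set.Icc (-0.0574) 0.0313 ∧ align X 3 1 ∈ Set.Icc 0.6803 0.9072 := by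
  obtain ⟨hσ, hσ', hc, hc', hal⟩ := cos_sin_alignAngle hX
  have hcs := Real.sin_sq_add_cos_sq (alignAngle X)
  obtain ⟨-, ⟨⟨h0, h0'⟩, hy0⟩, ⟨⟨h1, h1'⟩, hy1, hy1'⟩, ⟨⟨h2, h2'⟩, hy2, hy2'⟩,
    ⟨h3, h3'⟩, hy3, hy3'⟩ := hX
  have d0 : ∀ i, align X i 0 =
    Real.cos (alignAngle X) * X i 0 - Real.sin (alignAngle X) * X i 1 := fun i => by
    simp [align, rotate]
  have d1 : ∀ i, align X i 1 =
    Real.sin (alignAngle X) * X i 0 + Real.cos (alignAngle X) * X i 1 := fun i => by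
    simp [align, rotate]
  simp only [d0, d1, hy0, Set.mem_Icc, Set.mem_Ioi]
  generalize Real.cos (alignAngle X) = c at *
  generalize Real.sin (alignAngle X) = σ at *
  generalize X 0 0 = x₀ at *
  generalize X 1 0 = x₁ at *
  generalize X 1 1 = y₁ at *
  generalize X 2 0 = x₂ at *
  generalize X 2 1 = y₂ at *
  generalize X 3 0 = x₃ at *
  generalize X 3 1 = y₃ at *
  have hc0 : 0 ≤ c := by linarith
  have low : ∀ {κ v m : ℝ}, 0 ≤ κ → m ≤ v → κ * m ≤ κ * v := fun hκ hv =>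
    mul_le_mul_of_nonneg_left hv hκ
  have hσy₂ : 0 ≤ σ * y₂ := mul_nonneg hσ (by linarith)
  -- The aligned difference is horizontal, so its first coordinate carries the whole squared
  -- distance.
  have hsq : (c * x₀ - σ * 0 - (c * x₂ - σ * y₂)) ^ 2 = (x₀ - x₂) ^ 2 + y₂ ^ 2 := by
    linear_combination ((x₀ - x₂) ^ 2 + y₂ ^ 2) * hcs -
      (σ * (x₀ - x₂) - c * y₂) * hal
  refine ⟨?_, ?_, ?_, by linarith, ?_, ?_, ?_, ?_, ?_⟩
  · have := low hc0 (by linarith : 833 / 512 ≤ x₀ - x₂)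
    linarith
  · rw [hsq]
    have e₁ : 0 ≤ y₂ := by linarith
    have e₂ : y₂ ≤ 24 / 512 := by linarith
    have e₃ : 833 / 512 ≤ x₀ - x₂ := by linarith
    have e₄ : x₀ - x₂ ≤ 996 / 512 := by linarith
    constructor <;> nlinarith
  · have e₁ := low hc0 (by linarith : -65 / 512 ≤ x₀ + x₂)
    have e₂ := low hc0 (by linarith : x₀ + x₂ ≤ 98 / 512)
    have e₃ := low hσ (by linarith : y₂ ≤ 24 / 512)
    constructor <;> linarith
  · have e₁ := low hσ (by linarith : 433 / 512 ≤ x₀)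
    have e₂ := low hσ (by linarith : x₀ ≤ 498 / 512)
    constructor <;> linarith
  · have e₁ := low hc0 (by linarith : -16 / 512 ≤ x₁)
    have e₂ := low hc0 (by linarith : x₁ ≤ 16 / 512)
    have e₃ := low hσ (by linarith : -464 / 512 ≤ y₁)
    have e₄ := low hσ (by linarith : y₁ ≤ -349 / 512)
    constructor <;> linarith
  · have e₁ := low hσ (by linarith : -16 / 512 ≤ x₁)
    have e₂ := low hσ (by linarith : x₁ ≤ 16 / 512)
    have e₃ := low hc0 (by linarith : -464 / 512 ≤ y₁)
    have e₄ := low hc0 (by linarith : y₁ ≤ -349 / 512)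
    constructor <;> linarith
  · have e₁ := low hc0 (by linarith : -16 / 512 ≤ x₃)
    have e₂ := low hc0 (by linarith : x₃ ≤ 16 / 512)
    have e₃ := low hσ (by linarith : 349 / 512 ≤ y₃)
    have e₄ := low hσ (by linarith : y₃ ≤ 464 / 512)
    constructor <;> linarith
  · have e₁ := low hσ (by linarith : -16 / 512 ≤ x₃)
    have e₂ := low hσ (by linarith : x₃ ≤ 16 / 512)
    have e₃ := low hc0 (by linarith : 349 / 512 ≤ y₃)
    have e₄ := low hc0 (by linarith : y₃ ≤ 464 / 512)
    constructor <;> linarith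

/-! ### From the coordinate inequality to configurations in `SMALL`. -/

/-- The energy of the rhombus with semi-axes `a` and `b`. -/
theorem scaledEnergy_rhombus (t a b : ℝ) :
    scaledEnergy t ![!₂[a, 0], !₂[0, -b], !₂[-a, 0], !₂[0, b]] =
      2 * (1 + a ^ 2) ^ t + 2 * (1 + b ^ 2) ^ t + ((1 + a ^ 2) ^ 2 / (4 * a ^ 2)) ^ t +
        ((1 + b ^ 2) ^ 2 / (4 * b ^ 2)) ^ t +
        4 * ((1 + a ^ 2) * (1 + b ^ 2) / (a ^ 2 + b ^ 2)) ^ t := by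
  have e₁ : (a + a) ^ 2 = 4 * a ^ 2 := by ring
  have e₂ : (-b - b) ^ 2 = 4 * b ^ 2 := by ring
  simp [scaledEnergy, bond, height, e₁, e₂, ← sq]
  ring

theorem energy_lt_of_bounds {t a b u h k x₁ x₃ : ℝ} (ht : 6 ≤ t) (ht' : t ≤ 8)
    (ha : 2.6468 ≤ 4 * a ^ 2) (ha' : 4 * a ^ 2 ≤ 3.8) (hu : -0.13 ≤ 2 * u) (hu' : 2 * u ≤ 0.1916)
    (hh : 0 ≤ h) (hh' : h ≤ 0.0281) (hx₁ : -0.0313 ≤ x₁) (hx₁' : x₁ ≤ 0.0574)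
    (hy₁ : 0.6803 ≤ b - k) (hy₁' : b - k ≤ 0.9072) (hx₃ : -0.0574 ≤ x₃) (hx₃' : x₃ ≤ 0.0313)
    (hy₃ : 0.6803 ≤ b + k) (hy₃' : b + k ≤ 0.9072)
    (hne : u ≠ 0 ∨ h ≠ 0 ∨ k ≠ 0 ∨ x₁ ≠ 0 ∨ x₃ ≠ 0) :
    2 * (1 + a ^ 2) ^ t + 2 * (1 + b ^ 2) ^ t + ((1 + a ^ 2) ^ 2 / (4 * a ^ 2)) ^ t +
        ((1 + b ^ 2) ^ 2 / (4 * b ^ 2)) ^ t +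
        4 * ((1 + a ^ 2) * (1 + b ^ 2) / (a ^ 2 + b ^ 2)) ^ t <
      (1 + (a + u) ^ 2 + h ^ 2) ^ t + (1 + (a - u) ^ 2 + h ^ 2) ^ t +
        (1 + x₁ ^ 2 + (b - k) ^ 2) ^ t + (1 + x₃ ^ 2 + (b + k) ^ 2) ^ t +
        ((1 + (a + u) ^ 2 + h ^ 2) * (1 + (a - u) ^ 2 + h ^ 2) / (4 * a ^ 2)) ^ t +
        ((1 + x₁ ^ 2 + (b - k) ^ 2) * (1 + x₃ ^ 2 + (b + k) ^ 2) /
          ((x₁ - x₃) ^ 2 + 4 * b ^ 2)) ^ t +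
        ((1 + (a + u) ^ 2 + h ^ 2) * (1 + x₁ ^ 2 + (b - k) ^ 2) /
          ((a + u - x₁) ^ 2 + (b + h - k) ^ 2)) ^ t +
        ((1 + (a - u) ^ 2 + h ^ 2) * (1 + x₁ ^ 2 + (b - k) ^ 2) /
          ((a - u + x₁) ^ 2 + (b + h - k) ^ 2)) ^ t +
        ((1 + (a + u) ^ 2 + h ^ 2) * (1 + x₃ ^ 2 + (b + k) ^ 2) /
          ((a + u - x₃) ^ 2 + (b - h + k) ^ 2)) ^ t +
        ((1 + (a - u) ^ 2 + h ^ 2) * (1 + x₃ ^ 2 + (b + k) ^ 2) /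
          ((a - u + x₃) ^ 2 + (b - h + k) ^ 2)) ^ t := by
  have sq_le : ∀ {z m : ℝ}, -m ≤ z → z ≤ m → z ^ 2 ≤ m ^ 2 := fun h₁ h₂ => sq_le_sq' h₁ h₂
  have hb : 0.6803 ≤ b := by linarith
  have hy₁2 : (b - k) ^ 2 ≤ 0.9072 ^ 2 := sq_le (by linarith) (by linarith)
  have hy₃2 : (b + k) ^ 2 ≤ 0.9072 ^ 2 := sq_le (by linarith) (by linarith)
  have hb2 : 0.6803 ^ 2 ≤ b ^ 2 := by gcongr
  have hb2' : b ^ 2 ≤ 0.9072 ^ 2 := sq_le (by linarith) (by linarith)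
  have hh2 : h ^ 2 ≤ 0.0281 ^ 2 := sq_le (by linarith) (by linarith)
  have hk2 : k ^ 2 ≤ 0.11345 ^ 2 := sq_le (by linarith) (by linarith)
  have hg2 : (h - k) ^ 2 ≤ 0.14155 ^ 2 := sq_le (by linarith) (by linarith)
  have he₁ : (u - x₁) ^ 2 ≤ 0.1532 ^ 2 := sq_le (by linarith) (by linarith)
  have he₃ : (u - x₃) ^ 2 ≤ 0.1532 ^ 2 := sq_le (by linarith) (by linarith)
  have hv₁ : (b + h - k) ^ 2 ≤ 0.9353 ^ 2 := sq_le (by linarith) (by linarith)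
  have hv₃ : (b - h + k) ^ 2 ≤ 0.9353 ^ 2 := sq_le (by linarith) (by linarith)
  -- With `y = b + κ`, the bound `2 * b ≥ 0.6803 + y` leaves a concave quadratic in `y`, so the ends
  -- of `[0.6803, 0.9072]` decide; `c₂` encodes this. The factor `3.2` is `0.8 * 4`, as needed in
  -- `diagonal_le`.
  have hbk : ∀ κ : ℝ, 0.6803 ≤ b - κ → b + κ ≤ 0.9072 → 0.6803 ≤ b + κ →
      1 + (b + κ) ^ 2 ≤ 3.2 * b ^ 2 := by
    intro κ h₁ h₂ h₃
    have c₁ : (0.6803 + (b + κ)) ^ 2 ≤ (2 * b) ^ 2 := by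
      apply pow_le_pow_left₀ <;> linarith
    have c₂ := mul_nonneg (sub_nonneg.2 h₃) (sub_nonneg.2 h₂)
    linarith
  have hB₁ : 1 + (b - k) ^ 2 ≤ 3.2 * b ^ 2 := by
    have := hbk (-k) (by linarith) (by linarith) (by linarith)
    rwa [← sub_eq_add_neg] at this
  have hB₃ := hbk k (by linarith) (by linarith) (by linarith)
  exact energy_lt (t := t) (a := a) (b := b) (u := u) (h := h) (k := k) (x₁ := x₁)
    (x₃ := x₃) ht ht' (by linarith) (by linarith) (by linarith) (by linarith) (by linarith)
    (by linarith) (by linarith) (by linarith) (by linarith) (by linarith) (by linarith)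
    (by linarith) (by linarith) (ne_of_gt (by linarith)) (ne_of_gt (by linarith)) hB₁ hB₃ hne

/-- If the aligned configuration is not symmetric, then symmetrization lowers the energy. -/
theorem scaledEnergy_symmetrize_lt {t : ℝ} (ht : 6 ≤ t) (ht' : t ≤ 8) {X : Fin 4 → Plane}
    (hX : X ∈ SMALL) (hne : ¬ (align X 0 0 + align X 2 0 = 0 ∧ align X 0 1 = 0 ∧
      align X 1 1 + align X 3 1 = 0 ∧ align X 1 0 = 0 ∧ align X 3 0 = 0)) :
    scaledEnergy t (symmetrize X) < scaledEnergy t X := by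
  obtain ⟨-, ⟨ha, ha'⟩, ⟨hu, hu'⟩, h21, ⟨hh, hh'⟩, ⟨hx₁, hx₁'⟩, ⟨hy₁, hy₁'⟩, ⟨hx₃, hx₃'⟩,
    hy₃, hy₃'⟩ := align_bounds hX
  rw [← scaledEnergy_align t X]
  have hs : symmetrize X = ![!₂[(align X 0 0 - align X 2 0) / 2, 0],
      !₂[0, -((align X 3 1 - align X 1 1) / 2)], !₂[-((align X 0 0 - align X 2 0) / 2), 0],
      !₂[0, (align X 3 1 - align X 1 1) / 2]] := by
    have : (align X 1 1 - align X 3 1) / 2 = -((align X 3 1 - align X 1 1) / 2) := by ring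
    simp only [symmetrize, this, neg_neg]
  rw [hs, scaledEnergy_rhombus]
  simp only [scaledEnergy, bond, height, h21]
  generalize align X 0 1 = h at *
  generalize align X 1 0 = x₁ at *
  generalize align X 3 0 = x₃ at *
  obtain ⟨a, ea⟩ : ∃ a, a = (align X 0 0 - align X 2 0) / 2 := ⟨_, rfl⟩
  obtain ⟨u, eu⟩ : ∃ u, u = (align X 0 0 + align X 2 0) / 2 := ⟨_, rfl⟩
  obtain ⟨b, eb⟩ : ∃ b, b = (align X 3 1 - align X 1 1) / 2 := ⟨_, rfl⟩
  obtain ⟨k, ek⟩ : ∃ k, k = (align X 3 1 + align X 1 1) / 2 := ⟨_, rfl⟩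
  have e00 : align X 0 0 = a + u := by linarith
  have e20 : align X 2 0 = -(a - u) := by linarith
  have e11 : align X 1 1 = -(b - k) := by linarith
  have e31 : align X 3 1 = b + k := by linarith
  rw [← ea, ← eb, e00, e20, e11, e31]
  rw [e00, e20] at ha ha' hu hu' hne
  rw [e11] at hy₁ hy₁' hne
  rw [e31] at hy₃ hy₃' hne
  have ha2 : (a + u - -(a - u)) ^ 2 = 4 * a ^ 2 := by ring
  rw [ha2] at ha ha'
  have hmain := energy_lt_of_bounds (t := t) (a := a) (b := b) (u := u) (h := h) (k := k)
    (x₁ := x₁) (x₃ := x₃) ht ht' ha ha' (by linarith) (by linarith) hh hh' hx₁ hx₁'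
    (by linarith) (by linarith) hx₃ hx₃' hy₃ hy₃' (by
      by_contra hcon
      push Not at hcon
      obtain ⟨c₁, c₂, c₃, c₄, c₅⟩ := hcon
      exact hne ⟨by linarith, c₂, by linarith, c₄, c₅⟩)
  have q₁ : (a + u - -(a - u)) ^ 2 + (h - h) ^ 2 = 4 * a ^ 2 := by ring
  have q₂ : (x₁ - x₃) ^ 2 + (-(b - k) - (b + k)) ^ 2 = (x₁ - x₃) ^ 2 + 4 * b ^ 2 := by ring
  have q₃ : (h - -(b - k)) ^ 2 = (b + h - k) ^ 2 := by ring
  have q₄ : (h - (b + k)) ^ 2 = (b - h + k) ^ 2 := by ring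
  have q₅ : ∀ x : ℝ, (-(a - u) - x) ^ 2 = (a - u + x) ^ 2 := fun x => by ring
  rw [q₁, q₂, q₃, q₄, q₅, q₅, neg_sq, neg_sq]
  exact hmain

theorem symmetrize_mem_K4 {X : Fin 4 → Plane} (hX : X ∈ SMALL) : symmetrize X ∈ K4 := by
  obtain ⟨ha, -, -, -, -, -, ⟨-, hy₁⟩, -, hy₃, -⟩ := align_bounds hX
  refine ⟨(align X 0 0 - align X 2 0) / 2, -((align X 1 1 - align X 3 1) / 2), half_pos ha,
    by linarith, ?_⟩
  simp only [symmetrize, neg_neg]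

/-- Since `X 0` lies on the positive horizontal axis, its aligned copy can be on that axis only if
the sine of the angle vanishes. The cosine is positive, so the rotation is trivial. -/
theorem eq_symmetrize_of_align {X : Fin 4 → Plane} (hX : X ∈ SMALL)
    (h : align X 0 0 + align X 2 0 = 0 ∧ align X 0 1 = 0 ∧
      align X 1 1 + align X 3 1 = 0 ∧ align X 1 0 = 0 ∧ align X 3 0 = 0) :
    X = symmetrize X := by
  obtain ⟨hu, hh, hk, hx₁, hx₃⟩ := h
  obtain ⟨-, -, -, h21, -⟩ := align_bounds hX
  obtain ⟨-, -, hc, -, -⟩ := cos_sin_alignAngle hX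
  have hcs := Real.sin_sq_add_cos_sq (alignAngle X)
  obtain ⟨-, ⟨⟨h0, -⟩, hy0⟩, -⟩ := hX
  have hσ : Real.sin (alignAngle X) = 0 := by
    have e : align X 0 1 = Real.sin (alignAngle X) * X 0 0 := by simp [align, rotate, hy0]
    rw [e, mul_eq_zero] at hh
    exact hh.resolve_right (by intro h; rw [h] at h0; linarith)
  have hcos : Real.cos (alignAngle X) = 1 := by
    rw [hσ] at hcs
    nlinarith
  have hal : align X = X := by
    funext i
    ext j
    fin_cases j <;> simp [align, rotate, hσ, hcos]
  simp only [symmetrize]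
  rw [hal] at hu hh hk hx₁ hx₃ h21 ⊢
  funext i
  ext j
  fin_cases i <;> fin_cases j <;> simp <;> linarith

end FivePoint

theorem mainTheorem7 (s : ℝ) (hs : s ∈ Set.Icc (12 : ℝ) (15 + 25 / 512))
    (X : Fin 4 → FivePoint.Plane) (hX : X ∈ FivePoint.SMALL) :
    FivePoint.symmetrize X ∈ FivePoint.K4 ∧
      FivePoint.rieszEnergy s (FivePoint.symmetrize X) ≤ FivePoint.rieszEnergy s X ∧
      (FivePoint.rieszEnergy s (FivePoint.symmetrize X) = FivePoint.rieszEnergy s X ↔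
        X = FivePoint.symmetrize X) := by
  refine ⟨FivePoint.symmetrize_mem_K4 hX, ?_⟩
  obtain ⟨hs₁, hs₂⟩ := hs
  by_cases h : X = FivePoint.symmetrize X
  · rw [← h]
    simp
  · have hlt : FivePoint.rieszEnergy s (FivePoint.symmetrize X) < FivePoint.rieszEnergy s X := by
      rw [FivePoint.rieszEnergy_eq (by linarith), FivePoint.rieszEnergy_eq (by linarith)]
      have := FivePoint.scaledEnergy_symmetrize_lt (t := s / 2) (by linarith) (by linarith) hX
        (fun hc => h (FivePoint.eq_symmetrize_of_align hX hc))
      gcongr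
    exact ⟨hlt.le, iff_of_false hlt.ne h⟩
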